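/- Let $n\ge 1$ and $[n]=\{1,\dots,n\}$; products of permutations of $[n]$ are taken from left to right (the left factor acts first). Let $F_{\mathrm{down}}(n)$ (respectively $F_{\mathrm{up}}(n)$) be the set of sequences $s=(s_1,\dots,s_{n-1})$ of $n-1$ transpositions of $[n]$ whose product $s_1s_2\cdots s_{n-1}$ is the cycle $(n,\dots,2,1)$, mapping $i$ to $i-1$ for $i>1$ and $1$ to $n$ (respectively its inverse $(1,2,\dots,n)$), and let $\mathcal T_n$ be the set of trees with vertex set $[n]$. *The dual.* For $s\in F_{\mathrm{down}}(n)$ put $A_{k}=s_1\cdots s_{k}$ for $0\le k\le n-1$ (with $A_0=\mathrm{id}$). The dual of $s$ is $\mathcal D(s)=(s'_1,\dots,s'_{n-1})$ where, if $s_k=(x,y)$, then $s'_k=(x',y')$ with $A_{k-1}(x')=x$ and $A_{k-1}(y')=y$. One has $\mathcal D(s)\in F_{\mathrm{up}}(n)$. *The relabeling.* For $s\in F_{\mathrm{up}}(n)$, the graph on $[n]$ whose edge labeled $k$ joins $x$ and $y$ when $s_k=(x,y)$, $k=1,\dots,n-1$, is a tree. For a vertex $v\ne 1$ let $e_v$ be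 the edge incident to $v$ that is closest to the vertex $1$, i.e. the first edge on the path from $v$ to $1$. Then $\mathcal S(s)\in\mathcal T_n$ is obtained by keeping the label $1$ of the vertex $1$, giving every other vertex $v$ the new label $1+w$, where $w$ is the label of $e_v$, and erasing the edge labels. Let $\mathcal B=\mathcal S\circ\mathcal D: F_{\mathrm{down}}(n)\to\mathcal T_n$. *The indices.* Let $s\in F_{\mathrm{down}}(n)$. For an entry $s_k=(x,y)$ of $s$, write the product of $s$ as the cycle $(x,x_1,\dots,x_a,y,y_1,\dots,y_b)$; the C-Index (difference index) of $s_k$ is the minimum of the cardinalities of $\{x,x_1,\dots,x_a\}$ and $\{y,y_1,\dots,y_b\}$. For an edge $e$ of a tree $T\in\mathcal T_n$, the T-Index (edge-deletion index) of $e$ is the minimum of the numbers of vertices of the two connected components of $T$ with $e$ removed. **Theorem.** For every $n\ge1$ the function $\mathcal B:F_{\mathrm{down}}(n)\to\mathcal T_n$ is a bijection, and for every $s=(s_1,\dots,s_{n-1})\in F_{\mathrm{down}}(n)$, if $e_1,\dots,e_{n-1}$ are the edges of the tree $\mathcal B(s)$, then there is an equality of multisets $$\{\text{C-Index}(s_1),\dots,\text{C-Index}(s_{n-1})\}=\{\text{T-Index}(e_1),\dots,\text{T-Index}(e_{n-1})\}.$$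 -/

import Mathlib

/-!
The set `[n] = {1, …, n}` with `n = m + 1 ≥ 1` is modelled by `Fin (m + 1)`, the element
`i : Fin (m + 1)` standing for the number `i + 1`; in particular `0` stands for the vertex `1`.
The set `[n - 1]` of positions (edge labels) is modelled by `Fin m`, the element `k : Fin m`
standing for `k + 1`.
-/

namespace TreeDual

open Equiv

variable {m : ℕ}

/-- A sequence of `m` elements of the symmetric group on `[m + 1]`. -/
abbrev PermSeq (m : ℕ) : Type := Fin m → Perm (Fin (m + 1))

/-- A transposition sequence: every entry is a transposition. -/
def IsTranspositionSeq (s : PermSeq m) : Prop := ∀ k, (s k).IsSwap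

/-- `mindBody s k` is the left-to-right product of the first `k` entries of `s`: it applies
the first entry first.  (Multiplication of `Equiv.Perm` is composition, the right factor acting
first.)  As a mind-body assignment it sends each mind to the body containing it after the first
`k` body swaps. -/
def mindBody (s : PermSeq m) : Fin (m + 1) → Perm (Fin (m + 1)) :=
  Fin.induction 1 (fun k A => s k * A)

/-- The product of a transposition sequence, multiplied from left to right. -/
def product (s : PermSeq m) : Perm (Fin (m + 1)) := mindBody s (Fin.last m)

/-- The permutation `(1, 2, …, n)`. -/
def cycleUp (m : ℕ) : Perm (Fin (m + 1)) := finRotate (m + 1)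

/-- The permutation `(n, …, 2, 1)`, mapping `n` to `n - 1`, …, `2` to `1` and `1` to `n`. -/
def cycleDown (m : ℕ) : Perm (Fin (m + 1)) := (finRotate (m + 1))⁻¹

/-- Factorizations of `(n, …, 2, 1)` into `n - 1` transpositions. -/
def FDown (m : ℕ) : Set (PermSeq m) := {s | IsTranspositionSeq s ∧ product s = cycleDown m}

/-- Factorizations of `(1, 2, …, n)` into `n - 1` transpositions. -/
def FUp (m : ℕ) : Set (PermSeq m) := {s | IsTranspositionSeq s ∧ product s = cycleUp m}

/-- Trees with vertex set `[n]`. -/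
def Trees (m : ℕ) : Set (SimpleGraph (Fin (m + 1))) := {T | T.IsTree}

/-! ### The dual -/

/-- The mind-body dual of `t` in the assignment `A` (from minds to bodies): the transport of `t`
from bodies to minds.  It turns `(x, y)` into `(x', y')` with `A x' = x` and `A y' = y`,
see `mbDual_swap`. -/
def mbDual (A t : Perm (Fin (m + 1))) : Perm (Fin (m + 1)) := A⁻¹ * t * A

theorem mbDual_swap (A : Perm (Fin (m + 1))) (x y : Fin (m + 1)) :
    mbDual A (swap x y) = swap (A⁻¹ x) (A⁻¹ y) := by
  rw [mbDual, Equiv.swap_apply_apply]; simp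

/-- The dual sequence: its `k`-th entry is the mind-body dual of the `k`-th entry of `s` in the
assignment reached after the first `k - 1` body swaps. -/
def dual (s : PermSeq m) : PermSeq m := fun k => mbDual (mindBody s k.castSucc) (s k)

theorem mindBody_zero (s : PermSeq m) : mindBody s 0 = 1 := rfl

theorem mindBody_succ (s : PermSeq m) (k : Fin m) :
    mindBody s k.succ = s k * mindBody s k.castSucc := by
  simp [mindBody]

theorem isTranspositionSeq_dual {s : PermSeq m} (hs : IsTranspositionSeq s) :
    IsTranspositionSeq (dual s) := by
  intro k
  obtain ⟨x, y, hxy, h⟩ := hs k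
  refine ⟨_, _, ?_, by rw [dual, h, mbDual_swap]⟩
  simpa using hxy

theorem mindBody_dual {s : PermSeq m} (hs : IsTranspositionSeq s) (k : Fin (m + 1)) :
    mindBody (dual s) k = (mindBody s k)⁻¹ := by
  induction k using Fin.induction with
  | zero => simp [mindBody_zero]
  | succ k ih =>
    obtain ⟨x, y, hxy, h⟩ := hs k
    rw [mindBody_succ, mindBody_succ, ih, dual, mbDual, h]
    simp

theorem product_dual {s : PermSeq m} (hs : IsTranspositionSeq s) :
    product (dual s) = (product s)⁻¹ := mindBody_dual hs _

/-- The map `𝒟` from factorizations of `(n, …, 1)` to factorizations of `(1, …, n)`. -/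
def D (m : ℕ) (s : FDown m) : FUp m :=
  ⟨dual s.1, isTranspositionSeq_dual s.2.1, by
    rw [product_dual s.2.1, s.2.2, cycleDown, cycleUp, inv_inv]⟩

/-! ### The tree of a factorization -/

/-- The graph of a transposition sequence, without its edge labels; the edge labeled `k` joins
`x` and `y` when `s k = (x, y)`. -/
def graph (s : PermSeq m) : SimpleGraph (Fin (m + 1)) where
  Adj x y := x ≠ y ∧ ∃ k, s k = swap x y
  symm := ⟨fun x y h => ⟨h.1.symm, h.2.imp fun k hk => by rw [hk, swap_comm]⟩⟩
  loopless := ⟨fun _ h => h.1 rfl⟩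

theorem sym2_eq_of_swap_eq {x y z w : Fin (m + 1)} (hxy : x ≠ y)
    (h : swap x y = swap z w) : s(x, y) = s(z, w) := by
  have h1 : swap z w x = y := by rw [← h, swap_apply_left]
  rw [swap_apply_def] at h1
  split_ifs at h1 with h2 h3
  · rw [h2, h1]
  · rw [h3, ← h1, Sym2.eq_swap]
  · exact absurd h1 hxy

theorem eq_swap_apply {s : PermSeq m} (hs : IsTranspositionSeq s) {k : Fin m} {v : Fin (m + 1)}
    (hv : s k v ≠ v) : s k = swap v (s k v) := by
  obtain ⟨x, y, hxy, h⟩ := hs k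
  rw [h] at hv ⊢
  rw [swap_apply_def] at hv ⊢
  split_ifs at hv ⊢ with h1 h2
  · rw [h1]
  · rw [h2, swap_comm]
  · exact absurd rfl hv

theorem graph_adj_apply {s : PermSeq m} (hs : IsTranspositionSeq s) {k : Fin m} {v : Fin (m + 1)}
    (hv : s k v ≠ v) : (graph s).Adj v (s k v) :=
  ⟨hv.symm, k, eq_swap_apply hs hv⟩

theorem reachable_mindBody {s : PermSeq m} (hs : IsTranspositionSeq s) (v : Fin (m + 1))
    (k : Fin (m + 1)) : (graph s).Reachable v (mindBody s k v) := by
  induction k using Fin.induction with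
  | zero => simp [mindBody_zero]
  | succ k ih =>
    refine ih.trans ?_
    rw [mindBody_succ, Perm.mul_apply]
    by_cases h : s k (mindBody s k.castSucc v) = mindBody s k.castSucc v
    · rw [h]
    · exact (graph_adj_apply hs h).reachable

theorem connected_graph {s : PermSeq m} (hs : s ∈ FUp m) : (graph s).Connected := by
  have h0 : ∀ v, (graph s).Reachable 0 v := by
    intro v
    induction v using Fin.induction with
    | zero => exact SimpleGraph.Reachable.refl _
    | succ k ih =>
      refine ih.trans ?_
      have h := reachable_mindBody hs.1 k.castSucc (Fin.last m)
      have h2 : mindBody s (Fin.last m) = cycleUp m := hs.2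
      rw [h2, cycleUp, finRotate_apply, Fin.coeSucc_eq_succ] at h
      exact h
  exact ⟨fun u v => (h0 u).symm.trans (h0 v)⟩

/-- The edge of the graph of `s` labeled `k`. -/
theorem exists_edge {s : PermSeq m} (hs : IsTranspositionSeq s) (k : Fin m) :
    ∃ e : (graph s).edgeSet, ∀ x y, x ≠ y → s k = swap x y → e.1 = s(x, y) := by
  obtain ⟨x, y, hxy, h⟩ := hs k
  exact ⟨⟨s(x, y), hxy, k, h⟩, fun z w _ h' => sym2_eq_of_swap_eq hxy (h.symm.trans h')⟩

theorem isTree_graph {s : PermSeq m} (hs : s ∈ FUp m) :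
    (graph s).IsTree ∧ Function.Injective s := by
  have hc := connected_graph hs
  choose f hf using exists_edge hs.1
  have hsurj : Function.Surjective f := by
    rintro ⟨e, he⟩
    induction e using Sym2.ind with
    | _ x y =>
      obtain ⟨hxy, k, hk⟩ := he
      exact ⟨k, Subtype.ext (hf k x y hxy hk)⟩
  have h1 := hc.card_vert_le_card_edgeSet_add_one
  have h2 := Nat.card_le_card_of_surjective f hsurj
  rw [Nat.card_fin] at h1 h2
  have h3 : Nat.card (graph s).edgeSet = m := by omega
  refine ⟨SimpleGraph.isTree_iff_connected_and_card.2 ⟨hc, by rw [h3, Nat.card_fin]⟩, ?_⟩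
  have hbij := hsurj.bijective_of_nat_card_le (by rw [h3, Nat.card_fin])
  intro j k hjk
  obtain ⟨x, y, hxy, h⟩ := hs.1 j
  exact hbij.1 (Subtype.ext ((hf j x y hxy h).trans (hf k x y hxy (hjk ▸ h)).symm))

/-- The edge labeled `k` is incident to `v` and leads from `v` towards the vertex `1`: its other
endpoint `s k v` is closer to the vertex `1` than `v`. -/
def IsClosestEdge (s : PermSeq m) (v : Fin (m + 1)) (k : Fin m) : Prop :=
  s k v ≠ v ∧ (graph s).dist (s k v) 0 < (graph s).dist v 0

theorem existsUnique_closestEdge {s : PermSeq m} (hs : s ∈ FUp m) {v : Fin (m + 1)}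
    (hv : v ≠ 0) : ∃! k, IsClosestEdge s v k := by
  obtain ⟨ht, hinj⟩ := isTree_graph hs
  obtain ⟨p, hp, hpl⟩ := ht.connected.exists_path_of_dist v 0
  have key : ∀ k, IsClosestEdge s v k → s k v = p.snd := by
    rintro k ⟨hk, hd⟩
    obtain ⟨q, hq, hql⟩ := ht.connected.exists_path_of_dist (s k v) 0
    have hadj := graph_adj_apply hs.1 hk
    have h1 : (SimpleGraph.Walk.cons hadj q).length = (graph s).dist v 0 := by
      refine le_antisymm ?_ (SimpleGraph.dist_le _)
      rw [SimpleGraph.Walk.length_cons]; omega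
    have h2 := (ht.existsUnique_path v 0).unique hp
      (SimpleGraph.Walk.isPath_of_length_eq_dist _ h1)
    rw [h2]; simp
  refine existsUnique_of_exists_of_unique ?_ ?_
  · cases p with
    | nil => exact absurd rfl hv
    | @cons _ u _ hadj q =>
      obtain ⟨hne, k, hk⟩ := id hadj
      have hku : s k v = u := by rw [hk, swap_apply_left]
      refine ⟨k, by rw [hku]; exact hne.symm, ?_⟩
      rw [hku, ← hpl, SimpleGraph.Walk.length_cons]
      exact Nat.lt_succ_of_le (SimpleGraph.dist_le q)
  · intro j k hj hk
    apply hinj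
    rw [eq_swap_apply hs.1 hj.1, eq_swap_apply hs.1 hk.1, key j hj, key k hk]

/-- The label of the edge incident to `v` that is closest to the vertex `1`. -/
noncomputable def closestEdge {s : PermSeq m} (hs : s ∈ FUp m) {v : Fin (m + 1)}
    (hv : v ≠ 0) : Fin m := (existsUnique_closestEdge hs hv).choose

theorem closestEdge_spec {s : PermSeq m} (hs : s ∈ FUp m) {v : Fin (m + 1)}
    (hv : v ≠ 0) : IsClosestEdge s v (closestEdge hs hv) :=
  (existsUnique_closestEdge hs hv).choose_spec.1

/-- The new vertex labels: the vertex `1` keeps its label, and any other vertex `v` gets the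
label `1 + w`, where `w` is the label of the edge incident to `v` closest to the vertex `1`. -/
noncomputable def relabel {s : PermSeq m} (hs : s ∈ FUp m) (v : Fin (m + 1)) : Fin (m + 1) :=
  if hv : v = 0 then 0 else (closestEdge hs hv).succ

theorem relabel_injective {s : PermSeq m} (hs : s ∈ FUp m) :
    Function.Injective (relabel hs) := by
  intro u v h
  unfold relabel at h
  split_ifs at h with hu hv hv
  · rw [hu, hv]
  · exact absurd h.symm (Fin.succ_ne_zero _)
  · exact absurd h (Fin.succ_ne_zero _)
  · have h := Fin.succ_injective _ h
    have h1 := closestEdge_spec hs hu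
    have h2 := closestEdge_spec hs hv
    rw [← h] at h2
    by_contra huv
    have h3 := sym2_eq_of_swap_eq h1.1.symm
      ((eq_swap_apply hs.1 h1.1).symm.trans (eq_swap_apply hs.1 h2.1))
    rcases Sym2.eq_iff.1 h3 with h4 | h4
    · exact huv h4.1
    · have h5 := h1.2
      have h6 := h2.2
      rw [h4.2] at h5
      rw [← h4.1] at h6
      omega

/-- The map `𝒮` from factorizations of `(1, …, n)` to vertex-labeled trees: relabel the vertices
of the tree of the factorization and erase the edge labels. -/
noncomputable def S (m : ℕ) (s : FUp m) : Trees m :=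
  ⟨(graph s.1).map (relabel s.2), by
    have e : graph s.1 ≃g (graph s.1).map (relabel s.2) :=
      SimpleGraph.Iso.map
        (Equiv.ofBijective _ (Finite.injective_iff_bijective.1 (relabel_injective s.2))) (graph s.1)
    exact e.isTree_iff.1 (isTree_graph s.2).1⟩

/-- The map `ℬ = 𝒮 ∘ 𝒟` from factorizations of `(n, …, 1)` to vertex-labeled trees. -/
noncomputable def B (m : ℕ) : FDown m → Trees m := S m ∘ D m

/-! ### Indices -/

/-- For `y` in the `μ`-cycle `(x, x₁, …, x_a, y, y₁, …, y_b)` of `x`, the set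
`{x, x₁, …, x_a}`. -/
def arc (μ : Perm (Fin (m + 1))) (x y : Fin (m + 1)) : Set (Fin (m + 1)) :=
  {z | ∃ i : ℕ, z = (μ ^ i) x ∧ ∀ j ≤ i, (μ ^ j) x ≠ y}

/-- For a transposition `t = (x, y)` and a cycle `μ = (x, x₁, …, x_a, y, y₁, …, y_b)`, the
partition with the two blocks `{x, x₁, …, x_a}` and `{y, y₁, …, y_b}`. -/
def cPart (μ t : Perm (Fin (m + 1))) : Set (Set (Fin (m + 1))) :=
  {A | ∃ x y, x ≠ y ∧ t = swap x y ∧ A = arc μ x y}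

/-- For an edge `e` of a tree `T`, the partition whose blocks are the vertex sets of the connected
components of `T` with `e` removed. -/
def tPart (T : SimpleGraph (Fin (m + 1))) (e : Sym2 (Fin (m + 1))) : Set (Set (Fin (m + 1))) :=
  Set.range (fun C : (T.deleteEdges {e}).ConnectedComponent => C.supp)

/-- The size of a smallest block; `min (|A|, |B|)` for a partition `{A, B}`. -/
noncomputable def minBlock (P : Set (Set (Fin (m + 1)))) : ℕ := sInf (Set.ncard '' P)

/-- The C-Index (difference index) of a transposition `t` of the sequence `s`. -/
noncomputable def cIndex (s : PermSeq m) (t : Perm (Fin (m + 1))) : ℕ :=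
  minBlock (cPart (product s) t)

/-- The T-Index (edge-deletion index) of an edge `e` of the tree `T`. -/
noncomputable def tIndex (T : SimpleGraph (Fin (m + 1))) (e : Sym2 (Fin (m + 1))) : ℕ :=
  minBlock (tPart T e)

/-- The multiset of the C-Indices of the entries of `s`. -/
noncomputable def cIndices (s : PermSeq m) : Multiset ℕ :=
  (Finset.univ : Finset (Fin m)).val.map (fun k => cIndex s (s k))

/-- The multiset of the T-Indices of the edges of `T`. -/
noncomputable def tIndices (T : SimpleGraph (Fin (m + 1))) : Multiset ℕ :=
  T.edgeSet.toFinite.toFinset.val.map (fun e => tIndex T e)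

end TreeDual

namespace TreeDual

open Equiv

variable {m : ℕ}

/-! ### Transposition sequences and reachability -/

/-! `D` is bijective because duality is an involution: the prefix products of the dual are the
inverses of those of `s`.

For `S`, relabeling turns a factorization into the sequence on the tree whose entry `k` joins the
vertex `k.succ` to its parent. The tree alone determines that sequence (`IsParentSeq`). Two
factorizations with the same tree are therefore conjugate by a permutation fixing `0` and commuting
with `cycleUp m`, which must be the identity. Conversely, multiplying the edges of any tree in any
order gives a full cycle (`sameCycle_product`), so the parent sequence of a tree can be conjugated,
fixing `0`, into a factorization of `cycleUp m`; relabeling undoes the conjugation.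

For the indices, relabeling changes nothing, so it suffices to compare `s` with the tree of `dual
s`. If the product of `s` sends `z` to a point fixed by `s k`, then entries of the dual other than
the `k`-th carry that point back to `z`. Hence each of the two arcs cut out by `s k` is connected in
the tree without edge `k`; deleting that edge disconnects the tree, so the arcs are exactly its two
components (`tPart_graph_dual`). -/

theorem reachable_mindBody_mindBody {s : PermSeq m} {G : SimpleGraph (Fin (m + 1))}
    {i j : Fin (m + 1)} (hij : i ≤ j)
    (h : ∀ l : Fin m, i ≤ l.castSucc → l.succ ≤ j → ∀ v, s l v ≠ v → G.Adj v (s l v))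
    (v : Fin (m + 1)) : G.Reachable (mindBody s i v) (mindBody s j v) := by
  induction j using Fin.induction with
  | zero => rw [Fin.le_zero_iff.1 hij]
  | succ k ih =>
    rcases hij.eq_or_lt with rfl | hlt
    · exact SimpleGraph.Reachable.refl _
    · have hik : i ≤ k.castSucc := Fin.le_castSucc_iff.2 hlt
      refine (ih hik fun l hl hlk => h l hl (hlk.trans (Fin.castSucc_lt_succ).le)).trans ?_
      rw [mindBody_succ, Perm.mul_apply]
      by_cases hk : s k (mindBody s k.castSucc v) = mindBody s k.castSucc v
      · rw [hk]
      · exact (h k hik le_rfl _ hk).reachable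

theorem adj_deleteEdges_apply {s : PermSeq m} (hs : IsTranspositionSeq s)
    (hinj : Function.Injective s) {k l : Fin m} (hlk : l ≠ k) {x y : Fin (m + 1)}
    (hk : s k = swap x y) {v : Fin (m + 1)} (hv : s l v ≠ v) :
    ((graph s).deleteEdges {s(x, y)}).Adj v (s l v) := by
  refine SimpleGraph.deleteEdges_adj.2 ⟨graph_adj_apply hs hv, fun he => hlk (hinj ?_)⟩
  rw [eq_swap_apply hs hv, hk]
  rcases Sym2.eq_iff.1 (Set.mem_singleton_iff.1 he) with h | h
  · rw [h.2, h.1]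
  · rw [h.2, h.1, swap_comm]

theorem not_reachable_deleteEdges {G : SimpleGraph (Fin (m + 1))} (hG : G.IsAcyclic)
    {x y : Fin (m + 1)} (h : G.Adj x y) : ¬ (G.deleteEdges {s(x, y)}).Reachable x y :=
  SimpleGraph.isBridge_iff.1 (SimpleGraph.isAcyclic_iff_forall_adj_isBridge.1 hG h)

/-! ### The product of the edges of a tree is a full cycle -/

/-- The `P`-orbit of `x` avoids `y`, so `swap x y * P` follows `P` from `x` until the step that
would first return to `x`; the swap diverts that step to `y`. -/
theorem sameCycle_swap_mul_swap {α : Type*} [DecidableEq α] [Finite α] {P : Perm α} {x y : α}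
    (h : ¬ P.SameCycle x y) : (swap x y * P).SameCycle x y := by
  have key : ∀ r : ℕ, (∀ i, 0 < i → i ≤ r → (P ^ i) x ≠ x) →
      ((swap x y * P) ^ r) x = (P ^ r) x := by
    intro r
    induction r with
    | zero => simp
    | succ r ih =>
      intro hr
      rw [pow_succ', Perm.mul_apply, ih fun i h0 h1 => hr i h0 (h1.trans r.le_succ),
        Perm.mul_apply, ← Perm.mul_apply P, ← pow_succ',
        swap_apply_of_ne_of_ne (hr _ r.succ_pos le_rfl)]
      intro hy
      exact h ⟨(r + 1 : ℕ), by rw [zpow_natCast, hy]⟩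
  have hex : ∃ r, 0 < r ∧ (P ^ r) x = x :=
    ⟨orderOf P, orderOf_pos P, by rw [pow_orderOf_eq_one, Perm.one_apply]⟩
  classical
  obtain ⟨h0, h1⟩ := Nat.find_spec hex
  obtain ⟨r, hr⟩ : ∃ r, Nat.find hex = r + 1 := ⟨_, (Nat.succ_pred_eq_of_pos h0).symm⟩
  refine ⟨(r + 1 : ℕ), ?_⟩
  rw [zpow_natCast, pow_succ', Perm.mul_apply, key r, Perm.mul_apply, ← Perm.mul_apply P,
    ← pow_succ', ← hr, h1, swap_apply_left]
  intro i hi hir hx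
  exact Nat.find_min hex (by omega) ⟨hi, hx⟩

theorem sameCycle_of_forall_apply {α : Type*} [Finite α] {P Q : Perm α}
    (h : ∀ a, Q.SameCycle a (P a)) {a b : α} (hab : P.SameCycle a b) : Q.SameCycle a b := by
  obtain ⟨i, rfl⟩ := hab.exists_nat_pow_eq
  induction i with
  | zero => exact Perm.SameCycle.refl _ _
  | succ i ih =>
    rw [pow_succ', Perm.mul_apply]
    exact (ih ⟨i, by simp⟩).trans (h _)

/-- A step of `P` differs from one of `swap x y * P` only by exchanging `x` and `y`, which now share
a cycle: cycles merge and none is split. -/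
theorem sameCycle_swap_mul {α : Type*} [DecidableEq α] [Finite α] {P : Perm α} {x y : α}
    (h : ¬ P.SameCycle x y) {a b : α} (hab : P.SameCycle a b) :
    (swap x y * P).SameCycle a b := by
  have hxy := sameCycle_swap_mul_swap h
  refine sameCycle_of_forall_apply (fun a => ?_) hab
  have ha : (swap x y * P).SameCycle a (swap x y (P a)) := ⟨1, by simp⟩
  rw [swap_apply_def] at ha
  split_ifs at ha with h1 h2
  · rw [h1]; exact ha.trans hxy.symm
  · rw [h2]; exact ha.trans hxy
  · exact ha

/-- The entries before `k` move points only along edges other than edge `k`. That edge is a bridge,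
so its endpoints lie in different cycles of the prefix product, and multiplying by `s k` merges
these cycles. -/
theorem sameCycle_mindBody {s : PermSeq m} (hs : IsTranspositionSeq s)
    (hinj : Function.Injective s) (ht : (graph s).IsAcyclic) (k : Fin (m + 1)) :
    ∀ j : Fin m, j.castSucc < k → ∀ x y, s j = swap x y → (mindBody s k).SameCycle x y := by
  induction k using Fin.induction with
  | zero => intro j hj; exact absurd hj (Fin.not_lt_zero _)
  | succ k ih =>
    intro j hj x y hxy
    obtain ⟨z, w, hzw, hk⟩ := hs k
    have hnot : ¬ (mindBody s k.castSucc).SameCycle z w := by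
      intro hc
      refine not_reachable_deleteEdges ht (show (graph s).Adj z w from ⟨hzw, k, hk⟩) ?_
      obtain ⟨i, rfl⟩ := hc.exists_nat_pow_eq
      generalize hG : (graph s).deleteEdges _ = G
      have key : ∀ v, G.Reachable v (mindBody s k.castSucc v) := by
        intro v
        have := reachable_mindBody_mindBody (s := s) (G := G) (Fin.zero_le k.castSucc)
          (fun l _ hl u hu => by
            rw [← hG]
            refine adj_deleteEdges_apply hs hinj ?_ hk hu
            rintro rfl
            exact absurd hl (not_le.2 (Fin.castSucc_lt_succ))) v
        simpa [mindBody_zero] using this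
      clear hk hG hc hzw
      induction i with
      | zero => simp
      | succ i ih => rw [pow_succ', Perm.mul_apply]; exact ih.trans (key _)
    rw [mindBody_succ, hk]
    rcases (Fin.le_castSucc_iff.2 hj).eq_or_lt with h | h
    · obtain rfl := Fin.castSucc_injective _ h
      have hmem := sym2_eq_of_swap_eq hzw (hk.symm.trans hxy)
      rcases Sym2.eq_iff.1 hmem with ⟨rfl, rfl⟩ | ⟨rfl, rfl⟩
      · exact sameCycle_swap_mul_swap hnot
      · exact (sameCycle_swap_mul_swap hnot).symm
    · exact sameCycle_swap_mul hnot (ih j h x y hxy)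

theorem sameCycle_product {s : PermSeq m} (hs : IsTranspositionSeq s)
    (hinj : Function.Injective s) (ht : (graph s).IsTree) (a b : Fin (m + 1)) :
    (product s).SameCycle a b := by
  obtain ⟨p⟩ := ht.connected.preconnected a b
  induction p with
  | nil => exact Perm.SameCycle.refl _ _
  | cons h _ ih =>
    obtain ⟨_, k, hk⟩ := h
    exact (sameCycle_mindBody hs hinj ht.isAcyclic (Fin.last m) k (Fin.castSucc_lt_last k)
      _ _ hk).trans ih

theorem cycleUp_castSucc (k : Fin m) : cycleUp m k.castSucc = k.succ := by
  rw [cycleUp, finRotate_apply, Fin.coeSucc_eq_succ]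

/-- Every vertex is an iterated image of `0` under the rotation, and commuting carries the fixed
point along. -/
theorem eq_one_of_commute_cycleUp {τ : Perm (Fin (m + 1))} (h0 : τ 0 = 0)
    (h : Commute τ (cycleUp m)) : τ = 1 := by
  ext v
  congr 1
  induction v using Fin.induction with
  | zero => exact h0
  | succ k ih =>
    rw [← cycleUp_castSucc, ← Perm.mul_apply, h.eq, Perm.mul_apply, ih]; rfl

theorem exists_conj_eq_cycleUp {σ : Perm (Fin (m + 1))} (h : ∀ a b, σ.SameCycle a b) :
    ∃ π : Perm (Fin (m + 1)), π 0 = 0 ∧ π * σ * π⁻¹ = cycleUp m := by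
  have hc : σ.IsCycleOn ((Finset.univ : Finset (Fin (m + 1))) : Set (Fin (m + 1))) :=
    ⟨by simp, fun a _ b _ => h a b⟩
  have hsurj : Function.Surjective fun i : Fin (m + 1) => (σ ^ (i : ℕ)) 0 := by
    intro b
    obtain ⟨n, hn, hb⟩ := hc.exists_pow_eq (Finset.mem_univ 0) (Finset.mem_univ b)
    exact ⟨⟨n, by simpa using hn⟩, hb⟩
  -- Numbering the vertices along the cycle of `σ` from `0` on turns `σ` into the rotation; the
  -- wrap-around case is `σ ^ (m + 1)` fixing `0`.
  let f : Perm (Fin (m + 1)) := Equiv.ofBijective _ (Finite.surjective_iff_bijective.1 hsurj)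
  have hf : ∀ i, f i = (σ ^ (i : ℕ)) 0 := fun _ => rfl
  have hσ : σ * f = f * cycleUp m := by
    ext i
    congr 1
    rw [Perm.mul_apply, Perm.mul_apply, hf, hf, ← Perm.mul_apply, ← pow_succ']
    induction i using Fin.lastCases with
    | last =>
      rw [cycleUp, finRotate_last]
      simpa using hc.pow_card_apply (Finset.mem_univ 0)
    | cast k => rw [cycleUp_castSucc]; simp
  refine ⟨f⁻¹, ?_, by rw [inv_inv, mul_assoc, hσ, inv_mul_cancel_left]⟩
  rw [Perm.inv_eq_iff_eq, hf]; simp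

/-! ### Parents in rooted trees -/

/-- `u` is the neighbour of `v` on the path from `v` to the vertex `0`. -/
def IsParent (T : SimpleGraph (Fin (m + 1))) (v u : Fin (m + 1)) : Prop :=
  T.Adj v u ∧ T.dist u 0 < T.dist v 0

theorem IsParent.exists {T : SimpleGraph (Fin (m + 1))} (hT : T.IsTree) {v : Fin (m + 1)}
    (hv : v ≠ 0) : ∃ u, IsParent T v u := by
  obtain ⟨p, hpl⟩ := (hT.connected.preconnected v 0).exists_walk_length_eq_dist
  cases p with
  | nil => exact absurd rfl hv
  | @cons _ u _ hadj q =>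
    refine ⟨u, hadj, ?_⟩
    rw [← hpl, SimpleGraph.Walk.length_cons]
    exact Nat.lt_succ_of_le (SimpleGraph.dist_le q)

theorem IsParent.unique {T : SimpleGraph (Fin (m + 1))} (hT : T.IsTree)
    {v u w : Fin (m + 1)} (hu : IsParent T v u) (hw : IsParent T v w) : u = w := by
  obtain ⟨p, hp, -⟩ := hT.connected.exists_path_of_dist v 0
  have key : ∀ z, IsParent T v z → z = p.snd := by
    rintro z ⟨hadj, hd⟩
    obtain ⟨q, hq, hql⟩ := hT.connected.exists_path_of_dist z 0
    have h1 : (SimpleGraph.Walk.cons hadj q).length = T.dist v 0 := by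
      refine le_antisymm ?_ (SimpleGraph.dist_le _)
      -- Stepping to a parent and continuing along a shortest path is again a shortest walk, hence
      -- the unique path from `v` to `0`.
      rw [SimpleGraph.Walk.length_cons]; omega
    have h2 := (hT.existsUnique_path v 0).unique hp
      (SimpleGraph.Walk.isPath_of_length_eq_dist _ h1)
    rw [h2]; simp
  rw [key u hu, key w hw]

/-- The edge labels of `t` on the edges of the rooted tree `T` are induced by the vertex labels
of their endpoints farther from the root. -/
def IsParentSeq (T : SimpleGraph (Fin (m + 1))) (t : PermSeq m) : Prop :=
  ∀ k : Fin m, ∃ u, IsParent T k.succ u ∧ t k = swap k.succ u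

theorem IsParentSeq.exists {T : SimpleGraph (Fin (m + 1))} (hT : T.IsTree) :
    ∃ t : PermSeq m, IsParentSeq T t := by
  choose u hu using fun k : Fin m => IsParent.exists hT (Fin.succ_ne_zero k)
  exact ⟨fun k => swap k.succ (u k), fun k => ⟨u k, hu k, rfl⟩⟩

theorem IsParentSeq.unique {T : SimpleGraph (Fin (m + 1))} (hT : T.IsTree) {t t' : PermSeq m}
    (ht : IsParentSeq T t) (ht' : IsParentSeq T t') : t = t' := by
  funext k
  obtain ⟨u, hu, h⟩ := ht k
  obtain ⟨u', hu', h'⟩ := ht' k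
  rw [h, h', hu.unique hT hu']

theorem IsParentSeq.isTranspositionSeq {T : SimpleGraph (Fin (m + 1))} {t : PermSeq m}
    (ht : IsParentSeq T t) : IsTranspositionSeq t := fun k => by
  obtain ⟨u, hu, h⟩ := ht k
  exact ⟨_, _, hu.1.ne, h⟩

theorem IsParentSeq.injective {T : SimpleGraph (Fin (m + 1))} {t : PermSeq m}
    (ht : IsParentSeq T t) : Function.Injective t := by
  intro j k hjk
  obtain ⟨u, hu, h⟩ := ht j
  obtain ⟨w, hw, h'⟩ := ht k
  rcases Sym2.eq_iff.1 (sym2_eq_of_swap_eq hu.1.ne (h.symm.trans (hjk.trans h'))) with h1 | h1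
  · exact Fin.succ_injective _ h1.1
  · have h2 := hu.2
    have h3 := hw.2
    rw [h1.2] at h2
    rw [← h1.1] at h3
    omega

/-- Descending through parents reaches the root, so the parent edges already form a connected
subgraph; a tree is minimal among connected graphs. -/
theorem IsParentSeq.graph_eq {T : SimpleGraph (Fin (m + 1))} (hT : T.IsTree) {t : PermSeq m}
    (ht : IsParentSeq T t) : graph t = T := by
  have hle : graph t ≤ T := by
    rintro x y ⟨hxy, k, hk⟩
    obtain ⟨u, hu, h⟩ := ht k
    have h1 := sym2_eq_of_swap_eq hxy (hk.symm.trans h)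
    rw [← SimpleGraph.mem_edgeSet, h1]
    exact hu.1
  have hreach : ∀ d, ∀ v, T.dist v 0 = d → (graph t).Reachable v 0 := by
    intro d
    induction d using Nat.strong_induction_on with
    | _ d ih =>
      intro v hv
      induction v using Fin.cases with
      | zero => exact SimpleGraph.Reachable.refl _
      | succ k =>
        obtain ⟨u, hu, h⟩ := ht k
        have hadj : (graph t).Adj k.succ u := ⟨hu.1.ne, k, h⟩
        exact hadj.reachable.trans (ih _ (hv ▸ hu.2) u rfl)
  have hc : (graph t).Connected :=
    ⟨fun u v => (hreach _ u rfl).trans (hreach _ v rfl).symm⟩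
  exact le_antisymm hle ((SimpleGraph.isTree_iff_minimal_connected.1 hT).2 hc hle)

/-! ### Conjugation of sequences -/

/-- Conjugation of all entries of a sequence. -/
def conjSeq (π : Perm (Fin (m + 1))) (s : PermSeq m) : PermSeq m := fun k => π * s k * π⁻¹

theorem conjSeq_eq_swap {π : Perm (Fin (m + 1))} {s : PermSeq m} {k : Fin m}
    {x y : Fin (m + 1)} (h : s k = swap x y) : conjSeq π s k = swap (π x) (π y) := by
  rw [conjSeq, h, Equiv.swap_apply_apply]

theorem conjSeq_mul (π ρ : Perm (Fin (m + 1))) (s : PermSeq m) :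
    conjSeq π (conjSeq ρ s) = conjSeq (π * ρ) s := by
  funext k; simp [conjSeq, mul_assoc]

theorem conjSeq_one (s : PermSeq m) : conjSeq 1 s = s := by
  funext k; simp [conjSeq]

theorem isTranspositionSeq_conjSeq (π : Perm (Fin (m + 1))) {s : PermSeq m}
    (hs : IsTranspositionSeq s) : IsTranspositionSeq (conjSeq π s) := by
  intro k
  obtain ⟨x, y, hxy, h⟩ := hs k
  exact ⟨π x, π y, π.injective.ne hxy, conjSeq_eq_swap h⟩

theorem product_conjSeq (π : Perm (Fin (m + 1))) (s : PermSeq m) :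
    product (conjSeq π s) = π * product s * π⁻¹ := by
  have key : ∀ k, mindBody (conjSeq π s) k = π * mindBody s k * π⁻¹ := by
    intro k
    induction k using Fin.induction with
    | zero => simp [mindBody_zero]
    | succ k ih => rw [mindBody_succ, mindBody_succ, ih, conjSeq]; group
  exact key _

theorem graph_conjSeq (π : Perm (Fin (m + 1))) (s : PermSeq m) :
    graph (conjSeq π s) = (graph s).map π := by
  have key : ∀ (π : Perm (Fin (m + 1))) (s : PermSeq m), (graph s).map π ≤ graph (conjSeq π s) := by
    rintro π s _ _ h
    obtain ⟨x, y, ⟨hxy, k, hk⟩, rfl, rfl⟩ := (SimpleGraph.map_adj π.toEmbedding _ _ _).1 h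
    exact ⟨π.injective.ne hxy, k, conjSeq_eq_swap hk⟩
  refine le_antisymm (fun x y h => ?_) (key π s)
  -- The reverse inclusion is the same one applied to `π⁻¹` and the conjugated sequence.
  have h1 := key π⁻¹ (conjSeq π s) ((SimpleGraph.map_adj (π⁻¹).toEmbedding _ _ _).2
    ⟨x, y, h, rfl, rfl⟩)
  rw [conjSeq_mul, inv_mul_cancel, conjSeq_one] at h1
  exact (SimpleGraph.map_adj π.toEmbedding _ _ _).2 ⟨_, _, h1, by simp, by simp⟩

theorem dist_iso {V W : Type*} {G : SimpleGraph V} {H : SimpleGraph W} (φ : G ≃g H)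
    (hG : G.Connected) (u v : V) : H.dist (φ u) (φ v) = G.dist u v := by
  have hH : H.Connected := φ.connected_iff.1 hG
  refine le_antisymm ?_ ?_
  · obtain ⟨p, hp⟩ := (hG.preconnected u v).exists_walk_length_eq_dist
    rw [← hp, ← SimpleGraph.Walk.length_map φ.toHom p]
    exact SimpleGraph.dist_le _
  · obtain ⟨p, hp⟩ := (hH.preconnected (φ u) (φ v)).exists_walk_length_eq_dist
    rw [← hp, ← SimpleGraph.Walk.length_map φ.symm.toHom p]
    have h : ∀ w, φ.symm.toHom (φ w) = w := φ.symm_apply_apply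
    exact (SimpleGraph.dist_le ((p.map φ.symm.toHom).copy (h u) (h v))).trans
      (SimpleGraph.Walk.length_copy _ _ _).le

theorem isParent_map_iff {G : SimpleGraph (Fin (m + 1))} (hG : G.Connected)
    {π : Perm (Fin (m + 1))} (h0 : π 0 = 0) {v u : Fin (m + 1)} :
    IsParent (G.map π) (π v) (π u) ↔ IsParent G v u := by
  have hd : ∀ w, (G.map π).dist (π w) 0 = G.dist w 0 := by
    intro w
    have := dist_iso (SimpleGraph.Iso.map π G) hG w 0
    rw [← this]
    exact congrArg _ h0.symm
  rw [IsParent, IsParent, hd, hd]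
  exact and_congr_left fun _ => (SimpleGraph.Iso.map π G).map_adj_iff

/-! ### The map `S` is bijective -/

/-- The relabeling as a permutation of the vertices. -/
noncomputable def relabelPerm {s : PermSeq m} (hs : s ∈ FUp m) : Perm (Fin (m + 1)) :=
  Equiv.ofBijective _ (Finite.injective_iff_bijective.1 (relabel_injective hs))

theorem relabelPerm_zero {s : PermSeq m} (hs : s ∈ FUp m) : relabelPerm hs 0 = 0 := by
  change relabel hs 0 = 0
  rw [relabel, dif_pos rfl]

theorem relabelPerm_eq_succ {s : PermSeq m} (hs : s ∈ FUp m) {v : Fin (m + 1)} {k : Fin m}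
    (h : IsClosestEdge s v k) : relabelPerm hs v = k.succ := by
  have hv : v ≠ 0 := by
    rintro rfl
    simpa using h.2
  change relabel hs v = k.succ
  rw [relabel, dif_neg hv,
    (existsUnique_closestEdge hs hv).unique (closestEdge_spec hs hv) h]

/-- The relabeling is injective on a finite set, hence surjective, so the label `k.succ` is used. -/
theorem exists_isClosestEdge {s : PermSeq m} (hs : s ∈ FUp m) (k : Fin m) :
    ∃ v, IsClosestEdge s v k := by
  obtain ⟨v, hv⟩ := (relabelPerm hs).surjective k.succ
  have hv0 : v ≠ 0 := by
    rintro rfl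
    rw [relabelPerm_zero] at hv
    exact Fin.succ_ne_zero k hv.symm
  refine ⟨v, ?_⟩
  have h := closestEdge_spec hs hv0
  rwa [← Fin.succ_injective _ (hv.symm.trans (relabelPerm_eq_succ hs h))] at h

theorem IsClosestEdge.isParent {s : PermSeq m} (hs : IsTranspositionSeq s) {v : Fin (m + 1)}
    {k : Fin m} (h : IsClosestEdge s v k) : IsParent (graph s) v (s k v) :=
  ⟨graph_adj_apply hs h.1, h.2⟩

theorem coe_S (s : FUp m) :
    (S m s : SimpleGraph (Fin (m + 1))) = (graph s.1).map (relabelPerm s.2) := rfl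

theorem isParentSeq_conjSeq_relabelPerm (s : FUp m) :
    IsParentSeq (S m s : SimpleGraph (Fin (m + 1))) (conjSeq (relabelPerm s.2) s.1) := by
  intro k
  obtain ⟨v, hv⟩ := exists_isClosestEdge s.2 k
  refine ⟨relabelPerm s.2 (s.1 k v), ?_, ?_⟩
  · rw [coe_S, ← relabelPerm_eq_succ s.2 hv,
      isParent_map_iff (connected_graph s.2) (relabelPerm_zero s.2)]
    exact hv.isParent s.2.1
  · rw [← relabelPerm_eq_succ s.2 hv]
    exact conjSeq_eq_swap (eq_swap_apply s.2.1 hv.1)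

theorem S_injective (m : ℕ) : Function.Injective (S m) := by
  intro s s' h
  have h1 := isParentSeq_conjSeq_relabelPerm s
  have h2 := isParentSeq_conjSeq_relabelPerm s'
  rw [← h] at h2
  have h3 := h1.unique (S m s).2 h2
  set ρ := relabelPerm s.2 with hρ
  set ρ' := relabelPerm s'.2 with hρ'
  have hconj : conjSeq (ρ'⁻¹ * ρ) s.1 = s'.1 := by
    rw [← conjSeq_mul, h3, conjSeq_mul, inv_mul_cancel, conjSeq_one]
  have hprod := product_conjSeq (ρ'⁻¹ * ρ) s.1
  rw [hconj, s.2.2, s'.2.2] at hprod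
  have hone : ρ'⁻¹ * ρ = 1 := by
    refine eq_one_of_commute_cycleUp ?_ (mul_inv_eq_iff_eq_mul.1 hprod.symm)
    rw [Perm.mul_apply, hρ, relabelPerm_zero, Perm.inv_eq_iff_eq, hρ', relabelPerm_zero]
  rw [hone, conjSeq_one] at hconj
  exact Subtype.ext hconj

theorem S_surjective (m : ℕ) : Function.Surjective (S m) := by
  rintro ⟨T, hT⟩
  replace hT : T.IsTree := hT
  obtain ⟨t, ht⟩ := IsParentSeq.exists hT
  have hg := ht.graph_eq hT
  obtain ⟨π, h0, hπ⟩ := exists_conj_eq_cycleUp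
    (sameCycle_product ht.isTranspositionSeq ht.injective (by rwa [hg]))
  have hs : conjSeq π t ∈ FUp m :=
    ⟨isTranspositionSeq_conjSeq π ht.isTranspositionSeq, by rw [product_conjSeq, hπ]⟩
  -- Edge `k` of `conjSeq π t` leads from `π k.succ` to its parent, so relabeling sends `π k.succ`
  -- back to `k.succ`.
  have hrel : relabelPerm hs = π⁻¹ := by
    rw [eq_inv_iff_mul_eq_one]
    ext v
    congr 1
    rw [Perm.mul_apply, Perm.one_apply]
    induction v using Fin.cases with
    | zero => rw [h0, relabelPerm_zero]
    | succ k =>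
      obtain ⟨u, hu, hk⟩ := ht k
      have hk' := conjSeq_eq_swap (π := π) hk
      have hp := (isParent_map_iff hT.connected h0).2 hu
      refine relabelPerm_eq_succ hs ⟨?_, ?_⟩
      · rw [hk', swap_apply_left]; exact hp.1.ne'
      · rw [hk', swap_apply_left, graph_conjSeq, hg]; exact hp.2
  refine ⟨⟨_, hs⟩, Subtype.ext ?_⟩
  rw [coe_S, hrel, ← graph_conjSeq, conjSeq_mul, inv_mul_cancel, conjSeq_one, hg]

/-! ### The map `D` is bijective -/

theorem dual_dual {s : PermSeq m} (hs : IsTranspositionSeq s) : dual (dual s) = s := by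
  funext k
  rw [dual, mindBody_dual hs, mbDual, dual, mbDual]
  group

theorem D_bijective (m : ℕ) : Function.Bijective (D m) := by
  constructor
  · intro s s' h
    have h1 : dual s.1 = dual s'.1 := congrArg Subtype.val h
    exact Subtype.ext (by rw [← dual_dual s.2.1, h1, dual_dual s'.2.1])
  · intro s
    refine ⟨⟨dual s.1, isTranspositionSeq_dual s.2.1, ?_⟩, Subtype.ext (dual_dual s.2.1)⟩
    rw [product_dual s.2.1, s.2.2, cycleDown, cycleUp]

theorem B_bijective (m : ℕ) : Function.Bijective (B m) :=
  Function.Bijective.comp ⟨S_injective m, S_surjective m⟩ (D_bijective m)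

/-! ### Invariance of the edge-deletion indices under relabeling -/

theorem tIndex_map (π : Perm (Fin (m + 1))) (G : SimpleGraph (Fin (m + 1)))
    (e : Sym2 (Fin (m + 1))) : tIndex (G.map π) (e.map π) = tIndex G e := by
  have φ : G.deleteEdges {e} ≃g (G.map π).deleteEdges {e.map π} :=
    { toEquiv := π
      map_rel_iff' := by
        intro a b
        rw [SimpleGraph.deleteEdges_adj, SimpleGraph.deleteEdges_adj]
        refine and_congr (SimpleGraph.Iso.map π G).map_adj_iff (not_congr ?_)
        rw [Set.mem_singleton_iff, Set.mem_singleton_iff, ← Sym2.map_mk,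
          (Sym2.map.injective π.injective).eq_iff] }
  have hcard : ∀ C : (G.deleteEdges {e}).ConnectedComponent,
      (φ.connectedComponentEquiv C).supp.ncard = C.supp.ncard := fun C =>
    (Nat.card_congr (SimpleGraph.ConnectedComponent.isoEquivSupp φ C)).symm
  rw [tIndex, tIndex, minBlock, minBlock, tPart, tPart, ← Set.range_comp, ← Set.range_comp]
  congr 1
  rw [← φ.connectedComponentEquiv.surjective.range_comp]
  exact congrArg Set.range (funext hcard)

theorem tIndices_map (π : Perm (Fin (m + 1))) (G : SimpleGraph (Fin (m + 1))) :
    tIndices (G.map π) = tIndices G := by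
  have h : (G.map π).edgeSet.toFinite.toFinset =
      G.edgeSet.toFinite.toFinset.map π.toEmbedding.sym2Map := by
    ext e
    have := SimpleGraph.edgeSet_map π.toEmbedding G
    simp only [Equiv.coe_toEmbedding] at this
    simp [this]
  rw [tIndices, h, Finset.map_val, Multiset.map_map, tIndices]
  exact Multiset.map_congr rfl fun e _ => tIndex_map π G e

/-! ### Difference indices and edge-deletion indices -/

/-- Walking along the cycle from `x`, each step either stays in the current arc or lands on the
first point of the other. -/
theorem mem_arc_or_mem_arc {μ : Perm (Fin (m + 1))} {x y : Fin (m + 1)} (hxy : x ≠ y)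
    (hμ : ∀ z, μ.SameCycle x z) (z : Fin (m + 1)) : z ∈ arc μ x y ∨ z ∈ arc μ y x := by
  have hleft : ∀ {a b : Fin (m + 1)}, a ≠ b → a ∈ arc μ a b := fun h =>
    ⟨0, rfl, fun j hj => by rw [Nat.le_zero.1 hj]; exact h⟩
  have hstep : ∀ {a b w : Fin (m + 1)}, w ∈ arc μ a b → μ w = b ∨ μ w ∈ arc μ a b := by
    rintro a b _ ⟨i, rfl, hi⟩
    refine or_iff_not_imp_left.2 fun h => ⟨i + 1, by rw [pow_succ', Perm.mul_apply], ?_⟩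
    intro j hj
    rcases hj.eq_or_lt with rfl | hj
    · rwa [pow_succ', Perm.mul_apply]
    · exact hi j (Nat.le_of_lt_succ hj)
  obtain ⟨i, rfl⟩ := (hμ z).exists_nat_pow_eq
  induction i with
  | zero => exact Or.inl (hleft hxy)
  | succ i ih =>
    rw [pow_succ', Perm.mul_apply]
    rcases ih with h | h
    · rcases hstep h with h | h
      · exact Or.inr (by rw [h]; exact hleft hxy.symm)
      · exact Or.inl h
    · rcases hstep h with h | h
      · exact Or.inl (by rw [h]; exact hleft hxy)
      · exact Or.inr h

theorem reachable_of_mem_arc {μ : Perm (Fin (m + 1))} {x y : Fin (m + 1)}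
    {G : SimpleGraph (Fin (m + 1))} (h : ∀ z, μ z ≠ x → μ z ≠ y → G.Reachable z (μ z))
    {z : Fin (m + 1)} (hz : z ∈ arc μ x y) : G.Reachable x z := by
  obtain ⟨i, rfl, hi⟩ := hz
  induction i with
  | zero => simp
  | succ i ih =>
    have hy := hi (i + 1) le_rfl
    have hr := ih fun j hj => hi j (hj.trans i.le_succ)
    rw [pow_succ', Perm.mul_apply] at hy ⊢
    -- Nothing here forces `y` into the cycle of `x`, so the walk may return to `x`; it is then
    -- trivially reachable.
    by_cases hx : μ ((μ ^ i) x) = x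
    · rw [hx]
    · exact hr.trans (h _ hx hy)

/-- Two connected pieces covering the graph, with base points not connected to each other, are
automatically disjoint and are its components. -/
theorem range_supp_eq_pair {V : Type*} {G : SimpleGraph V} {x y : V} {A B : Set V}
    (hA : ∀ z ∈ A, G.Reachable x z) (hB : ∀ z ∈ B, G.Reachable y z)
    (hAB : ∀ z, z ∈ A ∨ z ∈ B) (hG : ¬ G.Reachable x y) :
    Set.range (fun C : G.ConnectedComponent => C.supp) = {A, B} := by
  have h1 : (G.connectedComponentMk x).supp = A := by
    ext z
    rw [SimpleGraph.ConnectedComponent.mem_supp_iff, SimpleGraph.ConnectedComponent.eq]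
    exact ⟨fun h => (hAB z).resolve_right fun hz => hG (h.symm.trans (hB z hz).symm),
      fun h => (hA z h).symm⟩
  have h2 : (G.connectedComponentMk y).supp = B := by
    ext z
    rw [SimpleGraph.ConnectedComponent.mem_supp_iff, SimpleGraph.ConnectedComponent.eq]
    exact ⟨fun h => (hAB z).resolve_left fun hz => hG ((hA z hz).trans h),
      fun h => (hB z h).symm⟩
  ext P
  rw [Set.mem_insert_iff, Set.mem_singleton_iff]
  constructor
  · rintro ⟨C, rfl⟩
    induction C using SimpleGraph.ConnectedComponent.ind with
    | _ z =>
      rcases hAB z with hz | hz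
      · left; rw [← h1, SimpleGraph.ConnectedComponent.eq.2 (hA z hz)]
      · right; rw [← h2, SimpleGraph.ConnectedComponent.eq.2 (hB z hz)]
  · rintro (rfl | rfl)
    · exact ⟨_, h1⟩
    · exact ⟨_, h2⟩

theorem cPart_swap (μ : Perm (Fin (m + 1))) {x y : Fin (m + 1)} (hxy : x ≠ y) :
    cPart μ (swap x y) = {arc μ x y, arc μ y x} := by
  ext P
  rw [Set.mem_insert_iff, Set.mem_singleton_iff]
  constructor
  · rintro ⟨a, b, _, h, rfl⟩
    rcases Sym2.eq_iff.1 (sym2_eq_of_swap_eq hxy h) with ⟨rfl, rfl⟩ | ⟨rfl, rfl⟩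
    · exact Or.inl rfl
    · exact Or.inr rfl
  · rintro (rfl | rfl)
    · exact ⟨x, y, hxy, rfl, rfl⟩
    · exact ⟨y, x, hxy.symm, swap_comm _ _, rfl⟩

/-- Multiplying the product of `s` by its `k`-th entry gives the inverse of the product of the
dual with its `k`-th entry left out, which preserves the components of the graph of the dual with
the `k`-th edge removed. -/
theorem reachable_product_of_ne {s : PermSeq m} (hs : IsTranspositionSeq s)
    (hinj : Function.Injective (dual s)) {k : Fin m} {x y x' y' : Fin (m + 1)}
    (hk : s k = swap x y) (hk' : dual s k = swap x' y') {z : Fin (m + 1)}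
    (hx : product s z ≠ x) (hy : product s z ≠ y) :
    ((graph (dual s)).deleteEdges {s(x', y')}).Reachable z (product s z) := by
  have hd := isTranspositionSeq_dual hs
  set w := product s z with hw
  have hsw : s k w = w := by rw [hk, swap_apply_of_ne_of_ne hx hy]
  have h1 := reachable_mindBody_mindBody (s := dual s) (Fin.zero_le k.castSucc)
    (fun l _ hl v hv => adj_deleteEdges_apply hd hinj
      (by rintro rfl; exact absurd hl (not_le.2 Fin.castSucc_lt_succ)) hk' hv) w
  have h2 := reachable_mindBody_mindBody (s := dual s) (Fin.le_last k.succ)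
    (fun l hl _ v hv => adj_deleteEdges_apply hd hinj
      (by rintro rfl; exact absurd hl (not_le.2 Fin.castSucc_lt_succ)) hk' hv) w
  have h3 : mindBody (dual s) (Fin.last m) w = z := by
    have : product (dual s) w = z := by rw [product_dual hs, hw, Perm.inv_eq_iff_eq]
    exact this
  -- Since `s k` fixes `w`, the `k`-th dual entry does not move the point reached from `w`, so the
  -- walk from `w` to `z` never uses edge `k`.
  have h4 : mindBody (dual s) k.succ w = mindBody (dual s) k.castSucc w := by
    rw [mindBody_dual hs, mindBody_dual hs, mindBody_succ, mul_inv_rev, Perm.mul_apply,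
      Perm.inv_eq_iff_eq.2 hsw.symm]
  rw [h3, h4] at h2
  rw [mindBody_zero, Perm.one_apply] at h1
  exact (h1.trans h2).symm

theorem tPart_graph_dual {s : PermSeq m} (hs : s ∈ FDown m) {k : Fin m} {x' y' : Fin (m + 1)}
    (hxy' : x' ≠ y') (hk' : dual s k = swap x' y') :
    tPart (graph (dual s)) s(x', y') = cPart (product s) (s k) := by
  obtain ⟨ht, hinj⟩ := isTree_graph (D m ⟨s, hs⟩).2
  change (graph (dual s)).IsTree at ht
  change Function.Injective (dual s) at hinj
  obtain ⟨x, y, hxy, hk⟩ := hs.1 k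
  have hmem : ∀ z, (product s).SameCycle x z := by
    intro z
    have h := sameCycle_product (isTranspositionSeq_dual hs.1) hinj ht x z
    rwa [product_dual hs.1, Perm.sameCycle_inv] at h
  have hr : ∀ z, product s z ≠ x → product s z ≠ y →
      ((graph (dual s)).deleteEdges {s(x', y')}).Reachable z (product s z) := fun z hx hy =>
    reachable_product_of_ne hs.1 hinj hk hk' hx hy
  have hA := fun z => reachable_of_mem_arc (z := z) hr
  have hB := fun z => reachable_of_mem_arc (z := z) fun z hy hx => hr z hx hy
  have hAB := mem_arc_or_mem_arc hxy hmem
  rw [hk, cPart_swap _ hxy, tPart]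
  refine range_supp_eq_pair hA hB hAB fun hreach => ?_
  refine not_reachable_deleteEdges ht.isAcyclic
    (show (graph (dual s)).Adj x' y' from ⟨hxy', k, hk'⟩) ?_
  -- The arcs start at `x` and `y`, while the deleted edge joins `x'` and `y'`. A connection from
  -- `x` to `y` would make the whole graph connected, and so would also join `x'` to `y'` across the
  -- bridge.
  have hall : ∀ z, ((graph (dual s)).deleteEdges {s(x', y')}).Reachable x z := fun z =>
    (hAB z).elim (hA z) fun h => hreach.trans (hB z h)
  exact (hall x').symm.trans (hall y')

theorem tIndices_graph_dual {s : PermSeq m} (hs : s ∈ FDown m) :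
    tIndices (graph (dual s)) = cIndices s := by
  have hd := isTranspositionSeq_dual hs.1
  have hinj : Function.Injective (dual s) := (isTree_graph (D m ⟨s, hs⟩).2).2
  choose x y hxy hk using hd
  have hedge : Function.Injective fun k => s(x k, y k) := by
    intro j k h
    refine hinj ?_
    rw [hk j, hk k]
    rcases Sym2.eq_iff.1 h with h | h
    · rw [h.1, h.2]
    · rw [h.1, h.2, swap_comm]
  have hset : (graph (dual s)).edgeSet.toFinite.toFinset =
      Finset.univ.map ⟨fun k => s(x k, y k), hedge⟩ := by
    ext e
    rw [Set.Finite.mem_toFinset, Finset.mem_map]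
    constructor
    · induction e using Sym2.ind with
      | _ a b =>
        rintro ⟨hab, k, h⟩
        exact ⟨k, Finset.mem_univ _, sym2_eq_of_swap_eq (hxy k) ((hk k).symm.trans h)⟩
    · rintro ⟨k, -, rfl⟩
      exact ⟨hxy k, k, hk k⟩
  rw [tIndices, hset, Finset.map_val, Multiset.map_map, cIndices]
  exact Multiset.map_congr rfl fun k _ => congrArg minBlock (tPart_graph_dual hs (hxy k) (hk k))

end TreeDual

theorem mainTheorem1 (m : ℕ) :
    Function.Bijective (TreeDual.B m) ∧
      ∀ s : TreeDual.FDown m,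
        TreeDual.cIndices (s : TreeDual.PermSeq m) =
          TreeDual.tIndices (TreeDual.B m s : SimpleGraph (Fin (m + 1))) := by
  refine ⟨TreeDual.B_bijective m, fun s => ?_⟩
  rw [← TreeDual.tIndices_graph_dual s.2]
  exact (TreeDual.tIndices_map (TreeDual.relabelPerm (TreeDual.D m s).2) _).symm
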